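/- Let $T$ be an infinite, locally finite tree (a connected acyclic graph with infinitely many vertices, every vertex having finite degree) that has a vertex of degree at least $3$. A set $S$ of vertices is resolving if for any two distinct vertices $a,b$ of $T$ there is $x\in S$ with $d(a,x)\neq d(b,x)$; a metric basis is a resolving set of minimum cardinality, and the metric dimension $\beta(T)$ is the cardinality of a metric basis if a finite resolving set exists, and is infinite otherwise. A branch of $T$ at a vertex $v$ is a maximal subtree of $T$ having $v$ as a leaf, and a branch path of $T$ at $v$ is a branch at $v$ that is a finite path or a one-way infinite path; $P_T(v)$ denotes the number of branch paths of $T$ at $v$. Suppose that $\beta(T)$ is finite. Then the set of vertices of degree at least $3$ is finite, $$\beta(T)=\sum_{\deg(v)\ge 3}\max\{P_T(v)-1,0\},$$ and the metric bases of $T$ are exactly the sets $S$ obtained in the following way: for each vertex $v$ with $P_T(v)=k\ge 2$, select $k-1$ vertices different from $v$ that lie on distinct branch paths of $T$ at $v$, and let $S$ be the set of all selected vertices. -/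

import Mathlib

universe u

/-- The vertex `x` resolves the pair `a`, `b` if its distances to `a` and `b` differ. -/
def SimpleGraph.Resolves {V : Type u} (G : SimpleGraph V) (x a b : V) : Prop :=
  G.dist a x ≠ G.dist b x

/-- A set of vertices is resolving if any two distinct vertices are resolved by one of its
elements. -/
def SimpleGraph.IsResolvingSet {V : Type u} (G : SimpleGraph V) (S : Set V) : Prop :=
  ∀ a b : V, a ≠ b → ∃ x ∈ S, G.Resolves x a b

/-- A metric basis is a resolving set of minimum cardinality. -/
def SimpleGraph.IsMetricBasis {V : Type u} (G : SimpleGraph V) (S : Set V) : Prop :=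
  G.IsResolvingSet S ∧ ∀ S' : Set V, G.IsResolvingSet S' → S.encard ≤ S'.encard

/-- The metric dimension: the minimum cardinality of a resolving set; it is `⊤` exactly when
there is no finite resolving set. -/
noncomputable def SimpleGraph.metricDim {V : Type u} (G : SimpleGraph V) : ℕ∞ :=
  ⨅ S : {S : Set V // G.IsResolvingSet S}, (S : Set V).encard

/-- The one-way infinite path: vertices `0, 1, 2, …`, consecutive numbers being adjacent. -/
def oneWayInfinitePath : SimpleGraph ℕ := SimpleGraph.hasse ℕ

/-- A subtree of `G` that has `v` as a leaf, that is, as a vertex of degree one. -/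
def SimpleGraph.IsSubtreeWithLeaf {V : Type u} (G : SimpleGraph V) (v : V)
    (B : G.Subgraph) : Prop :=
  B.coe.IsTree ∧ ∃! w : V, B.Adj v w

/-- A branch at `v` is a maximal subtree having `v` as a leaf. -/
def SimpleGraph.IsBranch {V : Type u} (G : SimpleGraph V) (v : V) (B : G.Subgraph) : Prop :=
  Maximal (G.IsSubtreeWithLeaf v) B

/-- A branch path at `v` is a branch at `v` that is a finite path or a one-way infinite path. -/
def SimpleGraph.IsBranchPath {V : Type u} (G : SimpleGraph V) (v : V) (B : G.Subgraph) : Prop :=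
  G.IsBranch v B ∧
    ((∃ n : ℕ, Nonempty (B.coe ≃g SimpleGraph.pathGraph n)) ∨
      Nonempty (B.coe ≃g oneWayInfinitePath))

/-- The number of branch paths at `v`. -/
noncomputable def SimpleGraph.numBranchPaths {V : Type u} (G : SimpleGraph V) (v : V) : ℕ∞ :=
  {B : G.Subgraph | G.IsBranchPath v B}.encard

/-- The vertices of `s` are different from `v` and lie on distinct branch paths at `v`:
they are assigned injectively to branch paths that contain them. -/
def SimpleGraph.OnDistinctBranchPaths {V : Type u} (G : SimpleGraph V) (v : V)
    (s : Set V) : Prop :=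
  ∃ f : V → G.Subgraph, Set.InjOn f s ∧
    ∀ x ∈ s, x ≠ v ∧ G.IsBranchPath v (f x) ∧ x ∈ (f x).verts

/-- `S` consists of a choice, for each vertex `v` with `k ≥ 2` branch paths, of `k - 1` vertices
different from `v` that lie on distinct branch paths at `v`. -/
def SimpleGraph.IsBranchSelection {V : Type u} (G : SimpleGraph V) (S : Set V) : Prop :=
  ∃ s : V → Set V,
    (∀ v : V, 2 ≤ G.numBranchPaths v →
      (s v).encard = G.numBranchPaths v - 1 ∧ G.OnDistinctBranchPaths v (s v)) ∧
    S = ⋃ v ∈ {v : V | 2 ≤ G.numBranchPaths v}, s v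

/-!
In a tree, distinct vertices `a` and `b` are equidistant from `x` exactly if the path joining them
has a midpoint and `x` is reached from that midpoint through neither of the branches containing
`a` and `b`. Hence a nonempty set `S` is resolving if and only if it misses at most one branch at
each vertex (`SimpleGraph.IsTree.isResolvingSet_of_beyond`,
`SimpleGraph.IsResolvingSet.inter_beyond_nonempty`). All consequences are drawn from this
criterion.

* A vertex of degree at least three has two branches that meet `S`, so it lies on a path between
  two elements of `S`. If `S` is finite, there are finitely many such vertices
  (`SimpleGraph.IsTree.finite_three_le_degree`).
* A branch is a path exactly if its vertices other than its starting point have degree at most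
  two (`SimpleGraph.IsTree.isBranchPath_iff`). So branch paths starting at different vertices of
  degree at least three are disjoint up to these starting points.
* A resolving set misses at most one of the branch paths at each vertex, so it contains a branch
  selection (`SimpleGraph.IsResolvingSet.exists_isBranchSelection_subset`).
* A branch that is not a path contains a vertex `u` of degree at least three which is farthest
  from the starting point. All branches at `u` except the one leading back are paths, there are
  at least two of them, and a branch selection meets one. Hence branch selections are resolving
  (`SimpleGraph.IsBranchSelection.isResolvingSet`).

By disjointness all branch selections have the cardinality given by the sum
(`SimpleGraph.IsBranchSelection.encard_eq`), so they are the resolving sets of minimum cardinality.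
-/

namespace SimpleGraph

/-! ### Distances in a tree -/

/-- For adjacent `v` and `w` in a tree, `G.beyond v w` is the set of vertices that are reached
from `v` through `w`, i.e. the component of `w` after `v` is deleted. It is encoded by distances:
`w` is one step closer than `v`. -/
def beyond {V : Type u} (G : SimpleGraph V) (v w : V) : Set V :=
  {x | G.dist v x = G.dist w x + 1}

namespace IsTree

variable {V : Type u} {T : SimpleGraph V}

lemma mem_beyond_self {v w : V} (h : T.Adj v w) : w ∈ T.beyond v w := by
  simp [beyond, dist_eq_one_iff_adj.2 h]

lemma notMem_beyond_self {v w : V} : v ∉ T.beyond v w := by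
  simp [beyond]

lemma ne_of_mem_beyond {v w x : V} (h : x ∈ T.beyond v w) : x ≠ v := by
  rintro rfl; exact notMem_beyond_self h

/-- The sets of vertices on the two sides of an edge are complementary. -/
lemma notMem_beyond_iff (hT : T.IsTree) {v w x : V} (h : T.Adj v w) :
    x ∉ T.beyond v w ↔ x ∈ T.beyond w v := by
  have := hT.dist_eq_dist_add_one_of_adj x h
  simp only [beyond, Set.mem_ofPred_eq, T.dist_comm (v := x)] at this ⊢
  omega

lemma exists_mem_beyond (hT : T.IsTree) {v x : V} (hx : x ≠ v) :
    ∃ w, T.Adj v w ∧ x ∈ T.beyond v w := by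
  obtain ⟨p, hp⟩ := hT.connected.exists_walk_length_eq_dist v x
  cases p with
  | nil => exact absurd rfl hx
  | @cons _ w _ h q =>
    refine ⟨w, h, ?_⟩
    by_contra hc
    rw [hT.notMem_beyond_iff h] at hc
    have := dist_le q
    simp only [beyond, Set.mem_ofPred_eq, Walk.length_cons] at hc hp
    omega

/-- A vertex has at most one neighbour through which a given vertex is reached: the geodesics
through two such neighbours would be two paths with the same ends. -/
lemma eq_of_mem_beyond (hT : T.IsTree) {v w w' x : V} (hw : T.Adj v w) (hw' : T.Adj v w')
    (hx : x ∈ T.beyond v w) (hx' : x ∈ T.beyond v w') : w = w' := by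
  obtain ⟨p, hp⟩ := hT.connected.exists_walk_length_eq_dist w x
  obtain ⟨q, hq⟩ := hT.connected.exists_walk_length_eq_dist w' x
  have h1 : (Walk.cons hw p).IsPath := Walk.isPath_of_length_eq_dist _ (by
    simpa [beyond, hp] using hx.symm)
  have h2 : (Walk.cons hw' q).IsPath := Walk.isPath_of_length_eq_dist _ (by
    simpa [beyond, hq] using hx'.symm)
  have := (hT.existsUnique_path v x).unique h1 h2
  exact (Walk.cons.inj this).1

/-- The only edge that leaves `T.beyond v w` is the one from `w` to `v`. -/
lemma eq_of_adj_of_mem_beyond (hT : T.IsTree) {v w a b : V} (h : T.Adj v w)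
    (hab : T.Adj a b) (ha : a ∈ T.beyond v w) (hb : b ∉ T.beyond v w) : a = w ∧ b = v := by
  rw [hT.notMem_beyond_iff h] at hb
  have hv := hT.dist_eq_dist_add_one_of_adj v hab
  have hw := hT.dist_eq_dist_add_one_of_adj w hab
  simp only [beyond, Set.mem_ofPred_eq] at ha hb
  have haw : a = w := by
    by_contra hne
    obtain ⟨c, hc, hcw⟩ := hT.exists_mem_beyond (Ne.symm hne)
    have hvc := hT.dist_eq_dist_add_one_of_adj v hc
    have hle : T.dist v c ≤ T.dist v w + T.dist w c := hT.connected.dist_triangle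
    rw [dist_eq_one_iff_adj.2 h] at hle
    simp only [beyond, Set.mem_ofPred_eq, T.dist_comm (v := w)] at hcw
    -- both `b` and `c` are the neighbour of `a` towards `v`, but they differ in distance to `w`
    have hbc : b = c := hT.eq_of_mem_beyond (v := a) (x := v) hab hc
      (by simp only [beyond, Set.mem_ofPred_eq, T.dist_comm (v := v)]; omega)
      (by simp only [beyond, Set.mem_ofPred_eq, T.dist_comm (v := v)]; omega)
    subst hbc
    omega
  subst haw
  rw [dist_self] at ha hw
  refine ⟨rfl, (hT.connected.dist_eq_zero_iff.1 ?_).symm⟩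
  omega

/-- Every path that leaves `T.beyond v w` passes through `v`. -/
lemma dist_eq_add_of_mem_beyond (hT : T.IsTree) {v w x y : V} (h : T.Adj v w)
    (hx : x ∈ T.beyond v w) (hy : y ∉ T.beyond v w) :
    T.dist x y = T.dist x v + T.dist v y := by
  classical
  obtain ⟨p, hp⟩ := hT.connected.exists_walk_length_eq_dist x y
  obtain ⟨d, hd, hd1, hd2⟩ := p.exists_boundary_dart _ hx hy
  have hv := (hT.eq_of_adj_of_mem_beyond h d.adj hd1 hd2).2
  have hs : v ∈ p.support := hv ▸ p.dart_snd_mem_support_of_mem_darts hd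
  have h1 := dist_le (p.takeUntil v hs)
  have h2 := dist_le (p.dropUntil v hs)
  have h3 := congrArg Walk.length (p.take_spec hs)
  rw [Walk.length_append] at h3
  have := hT.connected.dist_triangle (u := x) (v := v) (w := y)
  omega

/-- Going on from `u ∈ T.beyond v w` to a neighbour `z` away from `v` stays beyond `w`. -/
lemma beyond_subset_beyond (hT : T.IsTree) {v w u z : V} (h : T.Adj v w)
    (hu : u ∈ T.beyond v w) (huz : T.Adj u z) (hv : v ∉ T.beyond u z) :
    T.beyond u z ⊆ T.beyond v w := by
  intro x hx
  have h1 := hT.dist_eq_add_of_mem_beyond huz hx hv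
  have h2 := hT.connected.dist_triangle (u := w) (v := u) (w := x)
  by_contra hc
  rw [hT.notMem_beyond_iff h] at hc
  simp only [beyond, Set.mem_ofPred_eq] at hu hc
  rw [T.dist_comm (u := x) (v := v), T.dist_comm (u := x) (v := u),
    T.dist_comm (u := u) (v := v)] at h1
  omega

lemma dist_lt_dist_of_mem_beyond (hT : T.IsTree) {v u z x : V} (huz : T.Adj u z)
    (hv : v ∉ T.beyond u z) (hx : x ∈ T.beyond u z) : T.dist v u < T.dist v x := by
  have h1 := hT.dist_eq_add_of_mem_beyond huz hx hv
  have h2 := hT.connected.pos_dist_of_ne (ne_of_mem_beyond hx)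
  rw [T.dist_comm (u := x) (v := v), T.dist_comm (u := u) (v := v)] at h1
  omega

/-! ### Resolving sets in terms of the branches at each vertex -/

/-- Two vertices equidistant from all of `S ≠ ∅` yield a vertex (the midpoint between them) with
two branches that miss `S`. -/
lemma exists_disjoint_beyond (hT : T.IsTree) {S : Set V} {x₀ : V} (hx₀ : x₀ ∈ S) {a b : V}
    (hab : a ≠ b) (hS : ∀ x ∈ S, T.dist a x = T.dist b x) :
    ∃ v w w', T.Adj v w ∧ T.Adj v w' ∧ w ≠ w' ∧
      Disjoint S (T.beyond v w) ∧ Disjoint S (T.beyond v w') := by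
  -- move `a` and `b` towards each other; this brings both of them closer to all of `S`
  induction hn : T.dist a x₀ using Nat.strong_induction_on generalizing a b with
  | _ n ih =>
    have key : ∀ {a b : V}, a ≠ b → (∀ x ∈ S, T.dist a x = T.dist b x) →
        ∃ c, T.Adj a c ∧ ∀ x ∈ S, x ∈ T.beyond a c := by
      intro a b hab hS
      obtain ⟨c, hc, hbc⟩ := hT.exists_mem_beyond hab.symm
      refine ⟨c, hc, fun x hx => ?_⟩
      by_contra hxc
      have h1 := hT.dist_eq_add_of_mem_beyond hc hbc hxc
      have h2 := hT.connected.pos_dist_of_ne hab.symm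
      have h3 := hS x hx
      omega
    obtain ⟨a', ha, ha'⟩ := key hab hS
    obtain ⟨b', hb, hb'⟩ := key hab.symm fun x hx => (hS x hx).symm
    by_cases hab' : a' = b'
    · subst hab'
      refine ⟨a', a, b, ha.symm, hb.symm, hab, ?_, ?_⟩
      · exact Set.disjoint_left.2 fun x hx => (hT.notMem_beyond_iff ha.symm).2 (ha' x hx)
      · exact Set.disjoint_left.2 fun x hx => (hT.notMem_beyond_iff hb.symm).2 (hb' x hx)
    · simp only [beyond, Set.mem_ofPred_eq] at ha' hb'
      refine ih (T.dist a' x₀) ?_ hab' (fun x hx => ?_) rfl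
      · have := ha' x₀ hx₀
        omega
      · have h1 := ha' x hx
        have h2 := hb' x hx
        have h3 := hS x hx
        omega

/-- A nonempty set that misses at most one branch at each vertex is resolving; the converse is
`SimpleGraph.IsResolvingSet.inter_beyond_nonempty`. -/
lemma isResolvingSet_of_beyond (hT : T.IsTree) {S : Set V} (hne : S.Nonempty)
    (h : ∀ v w w', T.Adj v w → T.Adj v w' → w ≠ w' →
      (S ∩ T.beyond v w).Nonempty ∨ (S ∩ T.beyond v w').Nonempty) : T.IsResolvingSet S := by
  intro a b hab
  by_contra! hc
  obtain ⟨x₀, hx₀⟩ := hne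
  obtain ⟨v, w, w', hw, hw', hww, h1, h2⟩ := hT.exists_disjoint_beyond hx₀ hab
    fun x hx => not_not.1 (hc x hx)
  rcases h v w w' hw hw' hww with h | h
  · exact h.ne_empty h1.inter_eq
  · exact h.ne_empty h2.inter_eq

lemma _root_.SimpleGraph.IsResolvingSet.inter_beyond_nonempty (hT : T.IsTree) {S : Set V}
    (hS : T.IsResolvingSet S) {v w w' : V} (hw : T.Adj v w) (hw' : T.Adj v w') (hne : w ≠ w') :
    (S ∩ T.beyond v w).Nonempty ∨ (S ∩ T.beyond v w').Nonempty := by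
  obtain ⟨x, hx, hr⟩ := hS w w' hne
  by_contra! hc
  have h1 : x ∉ T.beyond v w := fun h => (Set.eq_empty_iff_forall_notMem.1 hc.1) x ⟨hx, h⟩
  have h2 : x ∉ T.beyond v w' := fun h => (Set.eq_empty_iff_forall_notMem.1 hc.2) x ⟨hx, h⟩
  rw [hT.notMem_beyond_iff hw] at h1
  rw [hT.notMem_beyond_iff hw'] at h2
  exact hr (h1.trans h2.symm)

end IsTree

/-! ### Branches and branch paths -/

/-- The subgraph induced by `v` and everything beyond `w`: for adjacent `v`, `w` in a tree, this is
the branch at `v` that contains `w`. -/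
def branch {V : Type u} (G : SimpleGraph V) (v w : V) : G.Subgraph :=
  (⊤ : G.Subgraph).induce (insert v (G.beyond v w))

/-- The neighbours of `v` that lead into branches all of whose vertices, except possibly `v`, have
degree at most two in `G`. In a tree these branches are the branch paths at `v`. -/
def legNeighbors {V : Type u} (G : SimpleGraph V) [G.LocallyFinite] (v : V) : Set V :=
  {w | G.Adj v w ∧ ∀ x ∈ G.beyond v w, G.degree x ≤ 2}

namespace IsTree

variable {V : Type u} {T : SimpleGraph V}

lemma isSubtreeWithLeaf_branch (hT : T.IsTree) {v w : V} (h : T.Adj v w) :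
    T.IsSubtreeWithLeaf v (T.branch v w) := by
  have hadj : (T.branch v w).Adj v w :=
    ⟨Set.mem_insert _ _, Set.mem_insert_of_mem _ (mem_beyond_self h), h⟩
  refine ⟨⟨?_, hT.isAcyclic.subgraph _⟩, w, hadj, ?_⟩
  · have hw : w ∈ (T.branch v w).verts := hadj.snd_mem
    have key : ∀ n x, T.dist w x = n → ∀ hx : x ∈ T.beyond v w,
        (T.branch v w).coe.Reachable ⟨w, hw⟩ ⟨x, Set.mem_insert_of_mem _ hx⟩ := by
      intro n
      induction n with
      | zero =>
        intro x hn hx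
        obtain rfl := hT.connected.dist_eq_zero_iff.1 hn
        exact Reachable.refl _
      | succ n ih =>
        intro x hn hx
        have hne : w ≠ x := by rintro rfl; simp at hn
        obtain ⟨y, hxy, hy⟩ := hT.exists_mem_beyond hne
        have hyv : y ∈ T.beyond v w := by
          by_contra hc
          exact hne (hT.eq_of_adj_of_mem_beyond h hxy hx hc).1.symm
        simp only [beyond, Set.mem_ofPred_eq, T.dist_comm (v := w)] at hy
        refine (ih y (by omega) hyv).trans (Adj.reachable ?_)
        exact ⟨Set.mem_insert_of_mem _ hyv, Set.mem_insert_of_mem _ hx, hxy.symm⟩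
    have : ∀ x : (T.branch v w).verts, (T.branch v w).coe.Reachable ⟨w, hw⟩ x := by
      rintro ⟨x, hx⟩
      rcases Set.mem_insert_iff.1 hx with rfl | hx'
      · exact Adj.reachable hadj.symm
      · exact key _ x rfl hx'
    exact (connected_iff _).2 ⟨fun x y => (this x).symm.trans (this y), ⟨⟨w, hw⟩⟩⟩
  · rintro y ⟨-, hy, hvy⟩
    have hvy' : T.Adj v y := hvy
    rcases Set.mem_insert_iff.1 hy with rfl | hy
    · exact absurd hvy' T.irrefl
    · exact (hT.eq_of_adj_of_mem_beyond h hvy'.symm hy notMem_beyond_self).1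

lemma le_branch (hT : T.IsTree) {v w : V} {B : T.Subgraph} (hB : B.coe.IsTree)
    (hw : B.Adj v w) (huniq : ∀ y, B.Adj v y → y = w) : B ≤ T.branch v w := by
  have hverts : ∀ x ∈ B.verts, x ∈ insert v (T.beyond v w) := by
    intro x hx
    by_contra hc
    obtain ⟨p⟩ := hB.connected ⟨v, hw.fst_mem⟩ ⟨x, hx⟩
    obtain ⟨d, -, hd1, hd2⟩ := p.exists_boundary_dart
      {y | (y : V) ∈ insert v (T.beyond v w)} (Set.mem_insert _ _) hc
    have hadj : B.Adj d.fst d.snd := d.adj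
    simp only [Set.mem_ofPred_eq, Set.mem_insert_iff, not_or] at hd1 hd2
    rcases hd1 with hd1 | hd1
    · rw [hd1] at hadj
      rw [huniq _ hadj] at hd2
      exact hd2.2 (mem_beyond_self hw.adj_sub)
    · exact hd2.1 (hT.eq_of_adj_of_mem_beyond hw.adj_sub hadj.adj_sub hd1 hd2.2).2
  exact ⟨hverts, fun a b hab => ⟨hverts _ hab.fst_mem, hverts _ hab.snd_mem, hab.adj_sub⟩⟩

lemma isBranch_iff (hT : T.IsTree) {v : V} {B : T.Subgraph} :
    T.IsBranch v B ↔ ∃ w, T.Adj v w ∧ B = T.branch v w := by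
  constructor
  · rintro ⟨⟨hB, w, hw, huniq⟩, hmax⟩
    have hle := hT.le_branch hB hw huniq
    exact ⟨w, hw.adj_sub,
      le_antisymm hle (hmax (hT.isSubtreeWithLeaf_branch hw.adj_sub) hle)⟩
  · rintro ⟨w, h, rfl⟩
    refine ⟨hT.isSubtreeWithLeaf_branch h, ?_⟩
    rintro B ⟨hB, w', hw', huniq⟩ hle
    obtain rfl : w = w' := huniq w (hle.2
      ⟨Set.mem_insert _ _, Set.mem_insert_of_mem _ (mem_beyond_self h), h⟩)
    exact hT.le_branch hB hw' huniq

lemma branch_injOn (hT : T.IsTree) (v : V) : Set.InjOn (T.branch v) {w | T.Adj v w} := by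
  intro w hw w' hw' h
  have : w ∈ (T.branch v w').verts := h ▸ Set.mem_insert_of_mem _ (mem_beyond_self hw)
  rcases Set.mem_insert_iff.1 this with rfl | hmem
  · exact absurd hw T.irrefl
  · exact hT.eq_of_mem_beyond hw hw' (mem_beyond_self hw) hmem

/-- The neighbour of `y` towards `v` also lies in the branch. -/
lemma exists_pred_mem_branch (hT : T.IsTree) {v w y : V} (h : T.Adj v w)
    (hy : y ∈ T.beyond v w) :
    ∃ z ∈ (T.branch v w).verts, T.Adj y z ∧ T.dist v y = T.dist v z + 1 := by
  obtain ⟨z, hz, hzv⟩ := hT.exists_mem_beyond (ne_of_mem_beyond hy).symm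
  refine ⟨z, ?_, hz, by simpa [beyond, T.dist_comm (v := v)] using hzv⟩
  by_contra hc
  have hc' := not_or.1 (mt Set.mem_insert_iff.2 hc)
  exact hc'.1 (hT.eq_of_adj_of_mem_beyond h hz hy hc'.2).2

variable [T.LocallyFinite]

lemma degree_le_two_of_injective (hT : T.IsTree) {v w x : V} (h : T.Adj v w)
    (g : (T.branch v w).verts → ℕ) (hg : Function.Injective g)
    (hadj : ∀ a b, (T.branch v w).coe.Adj a b → g a + 1 = g b ∨ g b + 1 = g a)
    (hx : x ∈ T.beyond v w) : T.degree x ≤ 2 := by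
  classical
  have hxB : x ∈ (T.branch v w).verts := Set.mem_insert_of_mem _ hx
  have hmem : ∀ y, T.Adj x y → y ∈ (T.branch v w).verts := by
    intro y hy
    by_contra hc
    have hc' := not_or.1 (mt Set.mem_insert_iff.2 hc)
    exact hc'.1 (hT.eq_of_adj_of_mem_beyond h hy hx hc'.2).2
  let f : V → ℕ := fun y => if hy : y ∈ (T.branch v w).verts then g ⟨y, hy⟩ else 0
  have hf : ∀ y (hy : y ∈ (T.branch v w).verts), f y = g ⟨y, hy⟩ := fun y hy => dif_pos hy
  rw [← card_neighborFinset_eq_degree]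
  calc (T.neighborFinset x).card ≤ ({g ⟨x, hxB⟩ + 1, g ⟨x, hxB⟩ - 1} : Finset ℕ).card := by
        refine Finset.card_le_card_of_injOn f ?_ ?_
        · intro y hy
          have hy' : T.Adj x y := by simpa using hy
          have := hadj ⟨x, hxB⟩ ⟨y, hmem y hy'⟩ ⟨hxB, hmem y hy', hy'⟩
          rw [hf y (hmem y hy')]
          simp only [Finset.coe_insert, Finset.coe_singleton, Set.mem_insert_iff,
            Set.mem_singleton_iff]
          omega
        · intro y hy z hz hyz
          have hy' : T.Adj x y := by simpa using hy
          have hz' : T.Adj x z := by simpa using hz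
          rw [hf y (hmem y hy'), hf z (hmem z hz')] at hyz
          exact congrArg Subtype.val (hg hyz)
    _ ≤ 2 := Finset.card_le_two

/-- A vertex of degree at most two has at most one neighbour away from `v`. -/
lemma eq_of_adj_of_dist_eq (hT : T.IsTree) {v z x y : V} (hzv : z ≠ v) (hz : T.degree z ≤ 2)
    (hx : T.Adj z x) (hy : T.Adj z y) (hvx : T.dist v x = T.dist v z + 1)
    (hvy : T.dist v y = T.dist v z + 1) : x = y := by
  classical
  by_contra hne
  obtain ⟨c, hc, hcv⟩ := hT.exists_mem_beyond hzv.symm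
  simp only [beyond, Set.mem_ofPred_eq, T.dist_comm (v := v)] at hcv
  have hxc : x ≠ c := by rintro rfl; omega
  have hyc : y ≠ c := by rintro rfl; omega
  have : ({x, y, c} : Finset V).card ≤ (T.neighborFinset z).card := by
    refine Finset.card_le_card fun t ht => ?_
    simp only [Finset.mem_insert, Finset.mem_singleton] at ht
    rw [mem_neighborFinset]
    rcases ht with rfl | rfl | rfl <;> assumption
  rw [Finset.card_eq_three.2 ⟨x, y, c, hne, hxc, hyc, rfl⟩, card_neighborFinset_eq_degree] at this
  omega

lemma dist_injOn_branch (hT : T.IsTree) {v w : V} (hw : w ∈ T.legNeighbors v) :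
    Set.InjOn (T.dist v) (T.branch v w).verts := by
  obtain ⟨h, hdeg⟩ := hw
  have key : ∀ n, ∀ x ∈ (T.branch v w).verts, ∀ y ∈ (T.branch v w).verts,
      T.dist v x = n → T.dist v y = n → x = y := by
    intro n
    induction n with
    | zero =>
      intro x _ y _ hxn hyn
      rw [← hT.connected.dist_eq_zero_iff.1 hxn, ← hT.connected.dist_eq_zero_iff.1 hyn]
    | succ n ih =>
      intro x hx y hy hxn hyn
      have hx' : x ∈ T.beyond v w :=
        (Set.mem_insert_iff.1 hx).resolve_left (by rintro rfl; simp at hxn)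
      have hy' : y ∈ T.beyond v w :=
        (Set.mem_insert_iff.1 hy).resolve_left (by rintro rfl; simp at hyn)
      obtain ⟨x', hx'B, hxx, hdx⟩ := hT.exists_pred_mem_branch h hx'
      obtain ⟨y', hy'B, hyy, hdy⟩ := hT.exists_pred_mem_branch h hy'
      obtain rfl := ih x' hx'B y' hy'B (by omega) (by omega)
      by_cases hv : x' = v
      · subst hv
        rw [(hT.eq_of_adj_of_mem_beyond h hxx hx' notMem_beyond_self).1,
          (hT.eq_of_adj_of_mem_beyond h hyy hy' notMem_beyond_self).1]
      · exact hT.eq_of_adj_of_dist_eq hv (hdeg x' ((Set.mem_insert_iff.1 hx'B).resolve_left hv))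
          hxx.symm hyy.symm hdx hdy
  exact fun x hx y hy hxy => key _ x hx y hy hxy rfl

lemma branch_adj_iff_dist (hT : T.IsTree) {v w : V} (hw : w ∈ T.legNeighbors v)
    (a b : (T.branch v w).verts) : (T.branch v w).coe.Adj a b ↔
      T.dist v a + 1 = T.dist v b ∨ T.dist v b + 1 = T.dist v a := by
  have key : ∀ a b : (T.branch v w).verts, T.dist v a + 1 = T.dist v b →
      T.Adj a b := by
    rintro ⟨a, ha⟩ ⟨b, hb⟩ hab
    have hb' : b ∈ T.beyond v w :=
      (Set.mem_insert_iff.1 hb).resolve_left (by rintro rfl; simp at hab)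
    obtain ⟨z, hzB, hz, hdz⟩ := hT.exists_pred_mem_branch hw.1 hb'
    simp only at hab
    obtain rfl := hT.dist_injOn_branch hw ha hzB (by omega)
    exact hz.symm
  constructor
  · rintro ⟨-, -, hab⟩
    have := hT.dist_eq_dist_add_one_of_adj v (v := a) (w := b) hab
    omega
  · rintro (hab | hab)
    · exact ⟨a.2, b.2, key a b hab⟩
    · exact ⟨a.2, b.2, (key b a hab).symm⟩

/-- A branch is a path exactly if its vertices, except possibly `v`, have degree at most two: then
the distance from `v` numbers its vertices consecutively. -/
lemma isBranchPath_iff (hT : T.IsTree) {v : V} {B : T.Subgraph} :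
    T.IsBranchPath v B ↔ ∃ w ∈ T.legNeighbors v, B = T.branch v w := by
  constructor
  · rintro ⟨hB, hpath⟩
    obtain ⟨w, h, rfl⟩ := hT.isBranch_iff.1 hB
    refine ⟨w, ⟨h, fun x hx => ?_⟩, rfl⟩
    rcases hpath with ⟨n, ⟨φ⟩⟩ | ⟨⟨φ⟩⟩
    · refine hT.degree_le_two_of_injective h (fun a => (φ a : ℕ))
        (Fin.val_injective.comp φ.injective) (fun a b hab => ?_) hx
      exact pathGraph_adj.1 (φ.map_adj_iff.2 hab)
    · refine hT.degree_le_two_of_injective h φ φ.injective (fun a b hab => ?_) hx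
      have : φ a ⋖ φ b ∨ φ b ⋖ φ a := φ.map_adj_iff.2 hab
      simpa [Nat.covBy_iff_add_one_eq] using this
  · rintro ⟨w, hw, rfl⟩
    refine ⟨hT.isBranch_iff.2 ⟨w, hw.1, rfl⟩, ?_⟩
    let f : (T.branch v w).verts → ℕ := fun a => T.dist v a
    have hf : Function.Injective f := fun a b hab =>
      Subtype.ext (hT.dist_injOn_branch hw a.2 b.2 hab)
    have hadj := hT.branch_adj_iff_dist hw
    -- the distances that occur form an initial segment of `ℕ`
    have hdown : ∀ n, n + 1 ∈ Set.range f → n ∈ Set.range f := by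
      rintro n ⟨⟨a, ha⟩, han⟩
      have ha' : a ∈ T.beyond v w :=
        (Set.mem_insert_iff.1 ha).resolve_left (by rintro rfl; simp [f] at han)
      obtain ⟨z, hzB, -, hdz⟩ := hT.exists_pred_mem_branch hw.1 ha'
      simp only [f] at han
      exact ⟨⟨z, hzB⟩, by simp only [f]; omega⟩
    by_cases hsurj : ∀ n, n ∈ Set.range f
    · refine Or.inr ⟨⟨Equiv.ofBijective f ⟨hf, hsurj⟩, ?_⟩⟩
      intro a b
      rw [hadj]
      change f a ⋖ f b ∨ f b ⋖ f a ↔ _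
      simp [Nat.covBy_iff_add_one_eq, f]
    · left
      push Not at hsurj
      classical
      have hlt : ∀ a, f a < Nat.find hsurj := by
        intro a
        by_contra! hle
        have := Nat.decreasingInduction' (P := fun k => k ∈ Set.range f)
          (fun k _ _ hk => hdown k hk) hle ⟨a, rfl⟩
        exact Nat.find_spec hsurj this
      refine ⟨Nat.find hsurj, ⟨⟨Equiv.ofBijective (fun a => (⟨f a, hlt a⟩ : Fin _))
        ⟨fun a b hab => hf (congrArg Fin.val hab), fun i => ?_⟩, ?_⟩⟩⟩
      · obtain ⟨a, ha⟩ := not_not.1 (Nat.find_min hsurj i.2)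
        exact ⟨a, Fin.ext ha⟩
      · intro a b
        rw [hadj, pathGraph_adj]
        exact Iff.rfl

lemma numBranchPaths_eq (hT : T.IsTree) (v : V) :
    T.numBranchPaths v = (T.legNeighbors v).encard := by
  have : {B : T.Subgraph | T.IsBranchPath v B} = T.branch v '' T.legNeighbors v := by
    ext B
    simp only [Set.mem_ofPred_eq, hT.isBranchPath_iff, Set.mem_image, eq_comm]
  rw [numBranchPaths, this, Set.InjOn.encard_image]
  exact (hT.branch_injOn v).mono fun w hw => hw.1

lemma onDistinctBranchPaths_iff (hT : T.IsTree) {v : V} {s : Set V} :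
    T.OnDistinctBranchPaths v s ↔ ∃ f : V → V, Set.InjOn f s ∧
      ∀ x ∈ s, f x ∈ T.legNeighbors v ∧ x ∈ T.beyond v (f x) := by
  classical
  constructor
  · rintro ⟨f, hf, hs⟩
    have hex : ∀ x ∈ s, ∃ w ∈ T.legNeighbors v, f x = T.branch v w := fun x hx =>
      hT.isBranchPath_iff.1 (hs x hx).2.1
    choose! g hg hgf using hex
    refine ⟨g, fun x hx y hy hxy => hf hx hy ?_, fun x hx => ⟨hg x hx, ?_⟩⟩
    · rw [hgf x hx, hgf y hy, hxy]
    · have := (hs x hx).2.2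
      rw [hgf x hx] at this
      exact (Set.mem_insert_iff.1 this).resolve_left (hs x hx).1
  · rintro ⟨f, hf, hs⟩
    refine ⟨fun x => T.branch v (f x), fun x hx y hy hxy => hf hx hy ?_, fun x hx => ?_⟩
    · exact hT.branch_injOn v (hs x hx).1.1 (hs y hy).1.1 hxy
    · exact ⟨ne_of_mem_beyond (hs x hx).2, hT.isBranchPath_iff.2 ⟨_, (hs x hx).1, rfl⟩,
        Set.mem_insert_of_mem _ (hs x hx).2⟩

end IsTree

/-! ### Vertices of degree at least three -/

lemma IsTree.finite_setOf_dist_le {V : Type u} {T : SimpleGraph V} [T.LocallyFinite]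
    (hT : T.IsTree) (v : V) (n : ℕ) : {x | T.dist v x ≤ n}.Finite := by
  induction n with
  | zero =>
    refine (Set.finite_singleton v).subset fun x hx => ?_
    exact (hT.connected.dist_eq_zero_iff.1 (Nat.le_zero.1 hx)).symm
  | succ n ih =>
    refine ((Set.finite_singleton v).union (ih.biUnion fun y _ =>
      (T.neighborFinset y).finite_toSet)).subset fun x hx => ?_
    by_cases hxv : v = x
    · exact Or.inl hxv.symm
    · obtain ⟨y, hy, hyx⟩ := hT.exists_mem_beyond hxv
      simp only [beyond, Set.mem_ofPred_eq, T.dist_comm (v := v)] at hyx hx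
      refine Or.inr (Set.mem_biUnion (x := y) ?_ (by simpa using hy.symm))
      simp only [Set.mem_ofPred_eq]
      omega

namespace IsTree

variable {V : Type u} {T : SimpleGraph V} [T.LocallyFinite]

/-- Two of the branches at a vertex of degree at least three meet a given resolving set. -/
lemma exists_inter_beyond_nonempty (hT : T.IsTree) {S : Set V} (hS : T.IsResolvingSet S) {v : V}
    (hv : 3 ≤ T.degree v) : ∃ w w', T.Adj v w ∧ T.Adj v w' ∧ w ≠ w' ∧
      (S ∩ T.beyond v w).Nonempty ∧ (S ∩ T.beyond v w').Nonempty := by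
  rw [← card_neighborFinset_eq_degree] at hv
  obtain ⟨a, b, c, ha, hb, hc, hab, hac, hbc⟩ := Finset.two_lt_card_iff.1 hv
  rw [mem_neighborFinset] at ha hb hc
  have h1 := hS.inter_beyond_nonempty hT ha hb hab
  have h2 := hS.inter_beyond_nonempty hT ha hc hac
  have h3 := hS.inter_beyond_nonempty hT hb hc hbc
  by_cases h : (S ∩ T.beyond v a).Nonempty
  · rcases h3 with h3 | h3
    · exact ⟨a, b, ha, hb, hab, h, h3⟩
    · exact ⟨a, c, ha, hc, hac, h, h3⟩
  · exact ⟨b, c, hb, hc, hbc, h1.resolve_left h, h2.resolve_left h⟩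

/-- A vertex of degree at least three lies on a path between two vertices of any resolving set, so
a finite resolving set leaves room for only finitely many of them. -/
lemma finite_three_le_degree (hT : T.IsTree) {S : Set V} (hS : T.IsResolvingSet S)
    (hfin : S.Finite) : {v | 3 ≤ T.degree v}.Finite := by
  refine (hfin.biUnion fun s _ => hfin.biUnion fun s' _ =>
    hT.finite_setOf_dist_le s (T.dist s s')).subset fun v hv => ?_
  obtain ⟨w, w', hw, hw', hne, ⟨s, hs, hsw⟩, ⟨s', hs', hsw'⟩⟩ :=
    hT.exists_inter_beyond_nonempty hS hv
  have := hT.dist_eq_add_of_mem_beyond hw hsw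
    fun h => hne (hT.eq_of_mem_beyond hw hw' h hsw')
  refine Set.mem_biUnion hs (Set.mem_biUnion hs' ?_)
  simp only [Set.mem_ofPred_eq]
  omega

/-- A branch that is not a path contains a vertex `u` with two branch paths pointing away from
`v`: take for `u` a vertex of degree at least three as far from `v` as possible. -/
lemma exists_legNeighbors_of_notMem (hT : T.IsTree) (hfin : {v | 3 ≤ T.degree v}.Finite)
    {v w : V} (h : T.Adj v w) (hw : w ∉ T.legNeighbors v) :
    ∃ u z z', z ∈ T.legNeighbors u ∧ z' ∈ T.legNeighbors u ∧ z ≠ z' ∧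
      T.beyond u z ⊆ T.beyond v w ∧ T.beyond u z' ⊆ T.beyond v w := by
  classical
  have hne : {u | u ∈ T.beyond v w ∧ 3 ≤ T.degree u}.Nonempty := by
    by_contra! hc
    refine hw ⟨h, fun x hx => ?_⟩
    by_contra hx3
    exact (Set.eq_empty_iff_forall_notMem.1 hc) x ⟨hx, by omega⟩
  obtain ⟨u, ⟨hu, hu3⟩, hmax⟩ := Set.exists_max_image _ (T.dist v)
    (hfin.subset fun u hu => hu.2) hne
  obtain ⟨c, hc, hvc⟩ := hT.exists_mem_beyond (ne_of_mem_beyond hu).symm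
  have hcard : 1 < ((T.neighborFinset u).erase c).card := by
    rw [Finset.card_erase_of_mem (by simpa using hc), card_neighborFinset_eq_degree]
    omega
  obtain ⟨z, hz, z', hz', hzz⟩ := Finset.one_lt_card.1 hcard
  have key : ∀ z ∈ (T.neighborFinset u).erase c,
      z ∈ T.legNeighbors u ∧ T.beyond u z ⊆ T.beyond v w := by
    intro z hz
    rw [Finset.mem_erase, mem_neighborFinset] at hz
    have hvz : v ∉ T.beyond u z := fun hvz => hz.1 (hT.eq_of_mem_beyond hz.2 hc hvz hvc)
    have hsub := hT.beyond_subset_beyond h hu hz.2 hvz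
    refine ⟨⟨hz.2, fun x hx => ?_⟩, hsub⟩
    by_contra hx3
    have h1 := hmax x ⟨hsub hx, by omega⟩
    have h2 := hT.dist_lt_dist_of_mem_beyond hz.2 hvz hx
    omega
  exact ⟨u, z, z', (key z hz).1, (key z' hz').1, hzz, (key z hz).2, (key z' hz').2⟩

/-- Branch paths at different vertices of degree at least three have nothing but possibly their
starting points in common. -/
lemma disjoint_beyond_of_legNeighbors (hT : T.IsTree) {v v' w w' : V} (hv : 3 ≤ T.degree v)
    (hv' : 3 ≤ T.degree v') (hne : v ≠ v') (hw : w ∈ T.legNeighbors v)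
    (hw' : w' ∈ T.legNeighbors v') : Disjoint (T.beyond v w) (T.beyond v' w') := by
  refine Set.disjoint_left.2 fun x hx hx' => ?_
  have h1 := hT.dist_eq_add_of_mem_beyond hw.1 hx (y := v') fun h => by
    have := hw.2 v' h
    omega
  have h2 := hT.dist_eq_add_of_mem_beyond hw'.1 hx' (y := v) fun h => by
    have := hw'.2 v h
    omega
  have h3 := hT.connected.pos_dist_of_ne hne
  omega

lemma finite_legNeighbors (v : V) : (T.legNeighbors v).Finite :=
  (T.neighborFinset v).finite_toSet.subset fun w hw => by simpa using hw.1

/-- If two branch paths leave a vertex of degree at most two, the whole tree is a path. -/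
lemma three_le_degree_of_two_le_numBranchPaths (hT : T.IsTree) (hdeg : ∃ v, 3 ≤ T.degree v)
    {v : V} (hv : 2 ≤ T.numBranchPaths v) : 3 ≤ T.degree v := by
  classical
  rw [hT.numBranchPaths_eq] at hv
  obtain ⟨w, w', hw, hw', hne⟩ := Set.one_lt_encard_iff.1 (lt_of_lt_of_le (by norm_num) hv)
  obtain ⟨x, hx⟩ := hdeg
  by_cases hxv : x = v
  · exact hxv ▸ hx
  obtain ⟨c, hc, hxc⟩ := hT.exists_mem_beyond hxv
  have hcw : w ≠ c := by
    rintro rfl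
    have := hw.2 x hxc
    omega
  have hcw' : w' ≠ c := by
    rintro rfl
    have := hw'.2 x hxc
    omega
  rw [← card_neighborFinset_eq_degree]
  refine Finset.two_lt_card_iff.2 ⟨w, w', c, ?_, ?_, ?_, hne, hcw, hcw'⟩
  · simpa using hw.1
  · simpa using hw'.1
  · simpa using hc

/-! ### Branch selections and resolving sets -/

/-- One fewer vertices than branch paths at `v`, chosen on distinct branch paths, miss at most one
of the branch paths. -/
lemma inter_beyond_nonempty_of_onDistinctBranchPaths (hT : T.IsTree) {v w w' : V} {s : Set V}
    (hcard : s.encard = T.numBranchPaths v - 1) (hs : T.OnDistinctBranchPaths v s)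
    (hw : w ∈ T.legNeighbors v) (hw' : w' ∈ T.legNeighbors v) (hne : w ≠ w') :
    (s ∩ T.beyond v w).Nonempty ∨ (s ∩ T.beyond v w').Nonempty := by
  obtain ⟨f, hf, hfs⟩ := hT.onDistinctBranchPaths_iff.1 hs
  by_contra! hc
  have hsub : insert w (insert w' (f '' s)) ⊆ T.legNeighbors v := by
    rintro y (rfl | rfl | ⟨x, hx, rfl⟩)
    · exact hw
    · exact hw'
    · exact (hfs x hx).1
  have h1 : w' ∉ f '' s := by
    rintro ⟨x, hx, rfl⟩
    exact (Set.eq_empty_iff_forall_notMem.1 hc.2) x ⟨hx, (hfs x hx).2⟩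
  have h2 : w ∉ insert w' (f '' s) := by
    rintro (h | ⟨x, hx, rfl⟩)
    · exact hne h
    · exact (Set.eq_empty_iff_forall_notMem.1 hc.1) x ⟨hx, (hfs x hx).2⟩
  have h3 := Set.encard_le_encard hsub
  rw [Set.encard_insert_of_notMem h2, Set.encard_insert_of_notMem h1, hf.encard_image, hcard,
    hT.numBranchPaths_eq, ← (finite_legNeighbors v).cast_ncard_eq] at h3
  norm_cast at h3
  omega

/-- A selection misses at most one branch path at each vertex, and it meets every other branch,
since such a branch contains two branch paths at some vertex further out. -/
lemma _root_.SimpleGraph.IsBranchSelection.isResolvingSet (hT : T.IsTree)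
    (hdeg : ∃ v, 3 ≤ T.degree v) (hfin : {v | 3 ≤ T.degree v}.Finite) {S : Set V}
    (hS : T.IsBranchSelection S) : T.IsResolvingSet S := by
  obtain ⟨s, hs, rfl⟩ := hS
  set S := ⋃ v ∈ {v : V | 2 ≤ T.numBranchPaths v}, s v with hSdef
  -- two branch paths at the same vertex are not both missed
  have hleg : ∀ v w w', w ∈ T.legNeighbors v → w' ∈ T.legNeighbors v → w ≠ w' →
      (S ∩ T.beyond v w).Nonempty ∨ (S ∩ T.beyond v w').Nonempty := by
    intro v w w' hw hw' hne
    have h2 : 2 ≤ T.numBranchPaths v := by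
      rw [hT.numBranchPaths_eq, ← Set.encard_pair hne]
      exact Set.encard_le_encard (by rintro y (rfl | rfl) <;> assumption)
    have hsub : s v ⊆ S := Set.subset_biUnion_of_mem (u := s) (show v ∈ {v | _} from h2)
    exact (hT.inter_beyond_nonempty_of_onDistinctBranchPaths (hs v h2).1 (hs v h2).2 hw hw'
      hne).imp (fun h => h.mono (Set.inter_subset_inter_left _ hsub))
      (fun h => h.mono (Set.inter_subset_inter_left _ hsub))
  have hnonleg : ∀ v w, T.Adj v w → w ∉ T.legNeighbors v → (S ∩ T.beyond v w).Nonempty := by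
    intro v w h hw
    obtain ⟨u, z, z', hz, hz', hne, hsub, hsub'⟩ := hT.exists_legNeighbors_of_notMem hfin h hw
    rcases hleg u z z' hz hz' hne with hz | hz
    · exact hz.mono (Set.inter_subset_inter_right _ hsub)
    · exact hz.mono (Set.inter_subset_inter_right _ hsub')
  have hmain : ∀ v w w', T.Adj v w → T.Adj v w' → w ≠ w' →
      (S ∩ T.beyond v w).Nonempty ∨ (S ∩ T.beyond v w').Nonempty := by
    intro v w w' hw hw' hne
    by_cases h1 : w ∈ T.legNeighbors v
    · by_cases h2 : w' ∈ T.legNeighbors v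
      · exact hleg v w w' h1 h2 hne
      · exact Or.inr (hnonleg v w' hw' h2)
    · exact Or.inl (hnonleg v w hw h1)
  refine hT.isResolvingSet_of_beyond ?_ hmain
  obtain ⟨v, hv⟩ := hdeg
  rw [← card_neighborFinset_eq_degree] at hv
  obtain ⟨a, b, -, ha, hb, -, hab, -⟩ := Finset.two_lt_card_iff.1 hv
  rw [mem_neighborFinset] at ha hb
  exact (hmain v a b ha hb hab).elim (fun h => h.mono Set.inter_subset_left)
    (fun h => h.mono Set.inter_subset_left)

lemma _root_.SimpleGraph.IsResolvingSet.exists_isBranchSelection_subset (hT : T.IsTree)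
    {S : Set V} (hS : T.IsResolvingSet S) : ∃ S' ⊆ S, T.IsBranchSelection S' := by
  have hex : ∀ v, ∃ s ⊆ S, s.encard = T.numBranchPaths v - 1 ∧ T.OnDistinctBranchPaths v s := by
    intro v
    set H := {w ∈ T.legNeighbors v | (S ∩ T.beyond v w).Nonempty} with hH
    -- at most one branch path is missed
    have hmiss : (T.legNeighbors v \ H).encard ≤ 1 := by
      refine Set.encard_le_one_iff.2 fun a b ha hb => ?_
      by_contra hne
      rcases hS.inter_beyond_nonempty hT ha.1.1 hb.1.1 hne with h | h
      · exact ha.2 ⟨ha.1, h⟩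
      · exact hb.2 ⟨hb.1, h⟩
    have hHcard : T.numBranchPaths v - 1 ≤ H.encard := by
      rw [hT.numBranchPaths_eq, tsub_le_iff_left,
        ← Set.encard_sdiff_add_encard_of_subset (Set.sep_subset _ _ : H ⊆ T.legNeighbors v)]
      gcongr
    obtain ⟨t, htH, ht⟩ := Set.exists_subset_encard_eq hHcard
    choose! g hg using fun w (hw : w ∈ H) => hw.2
    have hdist : ∀ w ∈ t, ∀ w' ∈ t, g w ∈ T.beyond v w' → w = w' := fun w hw w' hw' h =>
      hT.eq_of_mem_beyond (htH hw).1.1 (htH hw').1.1 (hg w (htH hw)).2 h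
    have hginj : Set.InjOn g t := fun w hw w' hw' h =>
      hdist w hw w' hw' (h ▸ (hg w' (htH hw')).2)
    refine ⟨g '' t, ?_, hginj.encard_image.trans ht, hT.onDistinctBranchPaths_iff.2 ?_⟩
    · rintro _ ⟨w, hw, rfl⟩
      exact (hg w (htH hw)).1
    · have hex : ∀ x ∈ g '' t, ∃ w ∈ t, g w = x := fun x hx => hx
      choose! f hf hgf using hex
      refine ⟨f, fun x hx y hy hxy => ?_, fun x hx => ⟨(htH (hf x hx)).1, ?_⟩⟩
      · rw [← hgf x hx, ← hgf y hy, hxy]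
      · have := (hg _ (htH (hf x hx))).2
        rwa [hgf x hx] at this
  choose s hsS hs using hex
  exact ⟨_, Set.iUnion₂_subset fun v _ => hsS v, s, fun v _ => hs v, rfl⟩

/-- The sets selected at different vertices are disjoint, so their cardinalities add up; vertices
with at most one branch path contribute zero to the sum. -/
lemma _root_.SimpleGraph.IsBranchSelection.encard_eq (hT : T.IsTree)
    (hdeg : ∃ v, 3 ≤ T.degree v) {W : Finset V} (hW : ∀ v, v ∈ W ↔ 3 ≤ T.degree v) {S : Set V}
    (hS : T.IsBranchSelection S) : S.encard = ∑ v ∈ W, max (T.numBranchPaths v - 1) 0 := by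
  classical
  obtain ⟨s, hs, rfl⟩ := hS
  have hD : {v | 2 ≤ T.numBranchPaths v} = ↑(W.filter fun v => 2 ≤ T.numBranchPaths v) := by
    ext v
    simp only [Set.mem_ofPred_eq, Finset.coe_filter, hW]
    exact ⟨fun h => ⟨hT.three_le_degree_of_two_le_numBranchPaths hdeg h, h⟩, fun h => h.2⟩
  have hdisj : {v | 2 ≤ T.numBranchPaths v}.PairwiseDisjoint s := by
    intro v hv v' hv' hne
    obtain ⟨f, -, hf⟩ := hT.onDistinctBranchPaths_iff.1 (hs v hv).2
    obtain ⟨f', -, hf'⟩ := hT.onDistinctBranchPaths_iff.1 (hs v' hv').2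
    refine Set.disjoint_left.2 fun x hx hx' => ?_
    exact Set.disjoint_left.1 (hT.disjoint_beyond_of_legNeighbors
      (hT.three_le_degree_of_two_le_numBranchPaths hdeg hv)
      (hT.three_le_degree_of_two_le_numBranchPaths hdeg hv') hne (hf x hx).1 (hf' x hx').1)
      (hf x hx).2 (hf' x hx').2
  rw [Set.Finite.encard_biUnion (by rw [hD]; exact Finset.finite_toSet _) hdisj, hD,
    finsum_mem_coe_finset, Finset.sum_filter]
  refine Finset.sum_congr rfl fun v _ => ?_
  rw [max_eq_left zero_le]
  split_ifs with h
  · exact (hs v h).1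
  · refine (tsub_eq_zero_of_le ?_).symm
    exact Order.le_of_lt_add_one (lt_of_lt_of_eq (not_le.1 h) one_add_one_eq_two.symm)

end IsTree

end SimpleGraph

theorem theorem4 {V : Type u} [Infinite V] (T : SimpleGraph V) [T.LocallyFinite]
    (hT : T.IsTree) (hdeg : ∃ v : V, 3 ≤ T.degree v) (hfin : T.metricDim ≠ ⊤) :
    (∃ W : Finset V, (∀ v : V, v ∈ W ↔ 3 ≤ T.degree v) ∧
      T.metricDim = ∑ v ∈ W, max (T.numBranchPaths v - 1) 0) ∧
    (∀ S : Set V, T.IsMetricBasis S ↔ T.IsBranchSelection S) := by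
  obtain ⟨S₀, hS₀, hS₀fin⟩ : ∃ S₀, T.IsResolvingSet S₀ ∧ S₀.Finite := by
    obtain ⟨⟨S, hS⟩, hlt⟩ := iInf_lt_iff.1 (lt_top_iff_ne_top.2 hfin)
    exact ⟨S, hS, Set.encard_lt_top_iff.1 hlt⟩
  have hWfin := hT.finite_three_le_degree hS₀ hS₀fin
  have hW : ∀ v, v ∈ hWfin.toFinset ↔ 3 ≤ T.degree v := fun v => hWfin.mem_toFinset
  set N := ∑ v ∈ hWfin.toFinset, max (T.numBranchPaths v - 1) 0 with hN
  have hsel : ∀ {S}, T.IsBranchSelection S → T.IsResolvingSet S ∧ S.encard = N := fun hS =>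
    ⟨hS.isResolvingSet hT hdeg hWfin, hS.encard_eq hT hdeg hW⟩
  have hle : ∀ {S}, T.IsResolvingSet S → N ≤ S.encard := fun hS => by
    obtain ⟨S', hsub, hS'⟩ := hS.exists_isBranchSelection_subset hT
    exact (hsel hS').2 ▸ Set.encard_le_encard hsub
  refine ⟨⟨hWfin.toFinset, hW, le_antisymm ?_ (le_iInf fun S => hle S.2)⟩, fun S => ⟨?_, ?_⟩⟩
  · obtain ⟨S, -, hS⟩ := hS₀.exists_isBranchSelection_subset hT
    exact (iInf_le (fun S : {S : Set V // T.IsResolvingSet S} => (S : Set V).encard)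
      ⟨S, (hsel hS).1⟩).trans_eq (hsel hS).2
  · rintro ⟨hS, hmin⟩
    -- a basis contains a selection, which is resolving and hence not smaller
    obtain ⟨S', hsub, hS'⟩ := hS.exists_isBranchSelection_subset hT
    have hfinS : S.Finite := Set.encard_lt_top_iff.1
      ((hmin S₀ hS₀).trans_lt (Set.encard_lt_top_iff.2 hS₀fin))
    rwa [← hfinS.eq_of_subset_of_encard_le' hsub (hmin S' (hsel hS').1)]
  · intro hS
    exact ⟨(hsel hS).1, fun S' hS' => (hsel hS).2 ▸ hle hS'⟩
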